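/- Let $K=\mathbb{F}_q$ be a finite field, let $d\ge 0$ be an integer, and suppose that $S=\mathrm{L}_d(q)=\mathrm{PSL}_d(K)=\mathrm{SL}_d(K)/Z(\mathrm{SL}_d(K))$ is a simple group. For $g\in S$ let $f(g)$ denote the number of one-dimensional subspaces of the natural module $V=K^d$ that are fixed by $g$, where the class of a matrix $M\in\mathrm{SL}_d(K)$ sends the line spanned by $v$ to the line spanned by $Mv$. Let $A$ and $B$ be nontrivial conjugacy classes of $S$ (that is, conjugacy classes other than $\{1\}$), and let $AB=\{ab : a\in A,\ b\in B\}$. Then $f$ is not constant on $AB$. In particular, $AB$ is not a conjugacy class of $S$; that is, the Arad--Herzog conjecture holds for $\mathrm{PSL}_d(q)$. -/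

import Mathlib

open scoped Pointwise LinearAlgebra.Projectivization

/-- For `g` in `L_d(K) = PSL_d(K) = SL_d(K) / Z(SL_d(K))`, the number of one-dimensional subspaces
of the natural module `K^d` that are fixed by `g`. The one-dimensional subspaces are the points of
the projectivization of `K^d`, and the class of a matrix `M` in `SL_d(K)` sends the line spanned
by `v` to the line spanned by `M v`. -/
noncomputable def numFixedOneSpaces {d : ℕ} {K : Type*} [Field K]
    (g : Matrix.ProjectiveSpecialLinearGroup (Fin d) K) : ℕ :=
  Nat.card {L : ℙ K (Fin d → K) // g • L = L}

/-!
Write `f(g)` for the number of lines of `K^d` fixed by `g`, let `q = |K|`, and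
`N_k = 1 + q + ⋯ + q^(k-1)`. The question is about noncentral `a, b` in `SL_d(K)`: the value
`f(a g b g⁻¹)` should depend on `g`. Suppose that it is always equal to `c`.

* The group `SL_d(K)` is 2-transitive on the `N_d` lines, so double counting gives
  `(N_d - 1) (c - 1) = (f(a) - 1) (f(b) - 1)` (`card_fixedBy_mul_conj`).
* Linearly independent families of vectors can be moved to each other by `SL_d(K)` up to scalars
  (`exists_specialLinearGroup_smul_eq`). If `g` moves the lines of `w` and `b w` to the lines of
  `v` and `a⁻¹ v`, then `a g b g⁻¹` fixes the line of `v`. So fixed lines of products arise from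
  configurations that exist both for `a⁻¹` and for `b`. As neither is scalar, each has a vector
  independent of its image, whence `c ≥ 1` (`exists_one_le_fixCard`).
* Let `c ≥ 2`, and let `α ≥ β` be the largest dimensions of eigenspaces of `a` and `b`. Moving
  one eigenspace into the other gives `c ≥ N_β`, while `f(a) ≤ N_{d-1} + 1` and
  `f(b) ≤ (q - 1) N_β`. This contradicts the product formula
  (`not_two_le_of_fixCard_mul_conj_eq`).
* Let `c = 1`. The product formula gives `f(a) = 1`, say. For `d ≥ 3` a common configuration of
  `a⁻¹` and `b` produces two fixed lines (`exists_two_le_fixCard`): an eigenvector independent of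
  some `v` and its image; or `v`, `T v`, `T² v` independent; or `v`, `T v`, `w`, `T w` independent.
  For `d = 2` an element with one fixed line has trace `± 2`, and the traces of the products
  `a g b g⁻¹` include the values of a quadratic polynomial over `K`, which are too many if `q ≥ 4`
  (`exists_fixCard_ne_one_of_dim_two`).

For `d = 2` and `q ≤ 3` the group acts faithfully on at most four lines. It is therefore solvable
and not simple (`four_le_card_of_isSimpleGroup`).
-/

/-! ### Fixed points in 2-transitive actions -/

/-- Orbit counting: if `G` is transitive on a finite set `O` containing `y₀`, then the elements
moving `y₀` into `S ⊆ O` make up the proportion `#S / #O` of `G`. -/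
lemma card_smul_mem_mul_card {G Y : Type*} [Group G] [Fintype G] [MulAction G Y] [DecidableEq Y]
    (O S : Finset Y) (hS : S ⊆ O) (y₀ : Y) (hmem : ∀ g : G, g • y₀ ∈ O)
    (htrans : ∀ y ∈ O, ∃ g : G, g • y₀ = y) :
    (Finset.univ.filter fun g : G => g • y₀ ∈ S).card * O.card = Fintype.card G * S.card := by
  classical
  have hfib : ∀ y ∈ O, (Finset.univ.filter fun g : G => g • y₀ = y).card
      = (Finset.univ.filter fun g : G => g • y₀ = y₀).card := by
    intro y hy
    obtain ⟨h, rfl⟩ := htrans y hy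
    refine Finset.card_bij (fun g _ => h⁻¹ * g) ?_ ?_ ?_
    · intro g hg
      simp only [Finset.mem_filter, Finset.mem_univ, true_and] at hg ⊢
      rw [mul_smul, hg, inv_smul_smul]
    · intro g _ g' _ h
      simpa using h
    · intro g hg
      refine ⟨h * g, ?_, by simp⟩
      simp only [Finset.mem_filter, Finset.mem_univ, true_and] at hg ⊢
      rw [mul_smul, hg]
  have key : ∀ T ⊆ O, (Finset.univ.filter fun g : G => g • y₀ ∈ T).card
      = T.card * (Finset.univ.filter fun g : G => g • y₀ = y₀).card := by
    intro T hT
    rw [Finset.card_eq_sum_card_fiberwise (f := fun g : G => g • y₀) (t := T)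
      (fun g hg => by simpa using hg), Finset.sum_const_nat]
    intro y hy
    rw [← hfib y (hT hy)]
    congr 1
    ext g
    simp only [Finset.mem_filter, Finset.mem_univ, true_and]
    exact ⟨fun h => h.2, fun h => ⟨h ▸ hy, h⟩⟩
  have hO : (Finset.univ.filter fun g : G => g • y₀ ∈ O) = Finset.univ := by
    ext g; simp [hmem g]
  have h1 := key O subset_rfl
  rw [hO, Finset.card_univ] at h1
  rw [key S hS, h1]
  ring

/-- If a finite group is 2-transitive on `X` and all products of `a` with conjugates of `b` have
the same number `c` of fixed points, then `(|X| - 1) (c - 1) = (f(a) - 1) (f(b) - 1)`, where `f`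
counts fixed points. This is multiplicativity on `A B` of the irreducible character `f - 1`. -/
theorem card_fixedBy_mul_conj {G X : Type*} [Group G] [Finite G] [Finite X] [MulAction G X]
    [MulAction.IsMultiplyPretransitive G X 2] (hX : 2 ≤ Nat.card X) (a b : G) (c : ℕ)
    (hc : ∀ g : G, Nat.card (MulAction.fixedBy X (a * (g * b * g⁻¹))) = c) :
    ((Nat.card X : ℤ) - 1) * (c - 1) =
      ((Nat.card (MulAction.fixedBy X a) : ℤ) - 1) * (Nat.card (MulAction.fixedBy X b) - 1) := by
  classical
  have := Fintype.ofFinite G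
  have := Fintype.ofFinite X
  have h2 : ∀ {x y z w : X}, x ≠ y → z ≠ w → ∃ g : G, g • x = z ∧ g • y = w :=
    MulAction.is_two_pretransitive_iff.1 inferInstance
  have h1 : MulAction.IsPretransitive G X := MulAction.isPretransitive_of_is_two_pretransitive
  have hf : ∀ g : G, Nat.card (MulAction.fixedBy X g)
      = (Finset.univ.filter fun x : X => g • x = x).card := by
    intro g
    rw [Nat.card_eq_fintype_card, Fintype.card_subtype]
    rfl
  simp only [hf] at hc ⊢
  rw [Nat.card_eq_fintype_card] at hX ⊢
  set N := Fintype.card X with hN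
  set fa := (Finset.univ.filter fun x : X => a • x = x).card with hfa
  set fb := (Finset.univ.filter fun x : X => b • x = x).card with hfb
  have hfa' : (Finset.univ.filter fun x : X => ¬ a • x = x).card = N - fa := by
    rw [hN, ← Finset.card_univ, ← Finset.card_filter_add_card_filter_not (s := Finset.univ)
      (fun x : X => a • x = x)]
    omega
  have hfb' : (Finset.univ.filter fun x : X => ¬ b • x = x).card = N - fb := by
    rw [hN, ← Finset.card_univ, ← Finset.card_filter_add_card_filter_not (s := Finset.univ)
      (fun x : X => b • x = x)]
    omega
  have hfaN : fa ≤ N := Finset.card_le_univ _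
  have hfbN : fb ≤ N := Finset.card_le_univ _
  let n : X → ℕ := fun y => (Finset.univ.filter fun g : G => a • g • b • y = g • y).card
  -- double counting of the pairs `(g, y)` such that `a g b g⁻¹` fixes `g y`
  have hsum : Fintype.card G * c = ∑ y, n y := by
    have : ∀ g : G, (Finset.univ.filter fun y : X => a • g • b • y = g • y).card = c := by
      intro g
      rw [← hc g]
      refine Finset.card_bij (fun y _ => g • y) ?_ ?_ ?_
      · intro y hy
        simpa [mul_smul] using hy
      · intro y _ y' _ h
        simpa using h
      · intro x hx
        exact ⟨g⁻¹ • x, by simpa [mul_smul] using hx, by simp⟩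
    rw [← Finset.card_univ, ← Finset.sum_const_nat (fun g _ => this g)]
    simp only [n, Finset.card_filter]
    rw [Finset.sum_comm]
  have hn1 : ∀ y, b • y = y → n y * N = Fintype.card G * fa := by
    intro y hy
    rw [hN, ← Finset.card_univ, hfa, ← card_smul_mem_mul_card (G := G) Finset.univ _
      (Finset.subset_univ _) y (fun _ => Finset.mem_univ _)
      (fun z _ => MulAction.exists_smul_eq G y z)]
    simp [n, hy]
  have hn2 : ∀ y, ¬ b • y = y → n y * (N * (N - 1)) = Fintype.card G * (N - fa) := by
    intro y hy
    have hO : (Finset.univ : Finset X).offDiag.card = N * (N - 1) := by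
      rw [Finset.offDiag_card, Finset.card_univ, Nat.mul_sub, mul_one]
    have hS : ((Finset.univ.filter fun x : X => ¬ a • x = x).image fun x => (a • x, x)).card
        = N - fa := by
      rw [Finset.card_image_of_injective _ fun x x' h => (Prod.mk.inj h).2, hfa']
    rw [← hO, ← hS, ← card_smul_mem_mul_card (G := G) _ _ _ (y, b • y)]
    · refine congrArg (· * _) (congrArg Finset.card ?_)
      ext g
      simp only [Finset.mem_filter, Finset.mem_univ, true_and, Finset.mem_image, Prod.smul_mk,
        Prod.mk.injEq]
      constructor
      · intro h
        refine ⟨g • b • y, ?_, h, rfl⟩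
        rw [h]
        intro h'
        exact hy (smul_left_cancel g h').symm
      · rintro ⟨x, -, hx, rfl⟩
        exact hx
    · intro g
      simpa using Ne.symm hy
    · rintro ⟨z, z'⟩ hz
      obtain ⟨g, hg, hg'⟩ := h2 (Ne.symm hy) (by simpa using hz : z ≠ z')
      exact ⟨g, by simp [hg, hg']⟩
    · intro p hp
      simp only [Finset.mem_image, Finset.mem_filter, Finset.mem_univ, true_and] at hp
      obtain ⟨x, hx, rfl⟩ := hp
      simpa using hx
  have hG : 0 < Fintype.card G := Fintype.card_pos
  have e1 : Fintype.card G * (c * (N * (N - 1))) =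
      Fintype.card G * (fb * fa * (N - 1) + (N - fb) * (N - fa)) := by
    rw [← mul_assoc, hsum, Finset.sum_mul,
      ← Finset.sum_filter_add_sum_filter_not Finset.univ (fun y : X => b • y = y),
      Finset.sum_congr rfl (g := fun _ => Fintype.card G * fa * (N - 1)),
      Finset.sum_const, Finset.sum_congr rfl (g := fun _ => Fintype.card G * (N - fa)),
      Finset.sum_const, hfb', ← hfb, smul_eq_mul, smul_eq_mul]
    · ring
    · intro y hy
      exact hn2 y (by simpa using hy)
    · intro y hy
      rw [← mul_assoc, hn1 y (by simpa using hy)]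
  have e2 := Nat.eq_of_mul_eq_mul_left hG e1
  zify [hfaN, hfbN, (by omega : 1 ≤ N)] at e2
  have hN0 : (N : ℤ) ≠ 0 := by omega
  apply mul_left_cancel₀ hN0
  linear_combination e2

/-! ### Configurations of vectors of an endomorphism -/

section LinearPatterns

variable {K V : Type*} [Field K] [AddCommGroup V] [Module K V]

lemma linearIndependent_triple_iff {a b c : V} : LinearIndependent K ![a, b, c] ↔
    ∀ x y z : K, x • a + y • b + z • c = 0 → x = 0 ∧ y = 0 ∧ z = 0 := by
  rw [Fintype.linearIndependent_iff]
  constructor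
  · intro h x y z hxyz
    have := h ![x, y, z] (by simpa [Fin.sum_univ_succ, ← add_assoc] using hxyz)
    exact ⟨this 0, this 1, this 2⟩
  · intro h g hg i
    have := h (g 0) (g 1) (g 2) (by simpa [Fin.sum_univ_succ, ← add_assoc] using hg)
    fin_cases i
    exacts [this.1, this.2.1, this.2.2]

lemma LinearIndependent.triple_of_pair {a b c : V} (h : LinearIndependent K ![a, b])
    (hc : ∀ x y : K, c ≠ x • a + y • b) : LinearIndependent K ![a, b, c] := by
  rw [LinearIndependent.pair_iff] at h
  rw [linearIndependent_triple_iff]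
  intro x y z hz
  have hz0 : z = 0 := by
    by_contra hz0
    apply hc (-(z⁻¹ * x)) (-(z⁻¹ * y))
    have := congrArg (fun t => z⁻¹ • t) hz
    simp only [smul_add, smul_smul, inv_mul_cancel₀ hz0, smul_zero, one_smul] at this
    linear_combination (norm := module) this
  subst hz0
  have := h x y (by simpa using hz)
  exact ⟨this.1, this.2, rfl⟩

lemma LinearIndependent.quadruple_of_triple {a b c d : V} (h : LinearIndependent K ![a, b, c])
    (hd : ∀ x y z : K, d ≠ x • a + y • b + z • c) : LinearIndependent K ![a, b, c, d] := by
  rw [linearIndependent_triple_iff] at h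
  rw [Fintype.linearIndependent_iff]
  intro g hg
  simp only [Fin.sum_univ_succ, Fin.sum_univ_zero] at hg
  change g 0 • a + (g 1 • b + (g 2 • c + (g 3 • d + 0))) = 0 at hg
  have hz0 : g 3 = 0 := by
    by_contra hz0
    apply hd (-((g 3)⁻¹ * g 0)) (-((g 3)⁻¹ * g 1)) (-((g 3)⁻¹ * g 2))
    have := congrArg (fun t => (g 3)⁻¹ • t) hg
    simp only [smul_add, smul_smul, inv_mul_cancel₀ hz0, smul_zero, one_smul] at this
    linear_combination (norm := module) this
  have := h (g 0) (g 1) (g 2) (by rw [← hg, hz0]; module)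
  intro i
  fin_cases i
  exacts [this.1, this.2.1, this.2.2, hz0]

lemma exists_notMem_span_range [FiniteDimensional K V] {n : ℕ} (v : Fin n → V)
    (h : n < Module.finrank K V) : ∃ w, w ∉ Submodule.span K (Set.range v) := by
  by_contra! hw
  have : Submodule.span K (Set.range v) = ⊤ := by
    rw [eq_top_iff]; exact fun w _ => hw w
  have h2 := finrank_range_le_card (R := K) v
  rw [Set.finrank, this, finrank_top, Fintype.card_fin] at h2
  omega

variable [FiniteDimensional K V] {T : V →ₗ[K] V}

/-- If an eigenspace has dimension at least two, it is not
contained in the plane `⟨v, T v⟩` of a vector `v` that is not an eigenvector; otherwise `T` is not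
scalar modulo an eigenline, since it would then be scalar on a hyperplane. -/
lemma exists_eigenvector_linearIndependent (hV : 3 ≤ Module.finrank K V)
    (hT : ∃ v, LinearIndependent K ![v, T v]) (he : ∃ u : V, u ≠ 0 ∧ ∃ μ : K, T u = μ • u) :
    ∃ (u v : V) (μ : K), T u = μ • u ∧ LinearIndependent K ![v, T v, u] := by
  by_contra! h
  obtain ⟨u, hu, μ, hμ⟩ := he
  obtain ⟨v, hv⟩ := hT
  have hinv : Submodule.span K {u} ≤ (Submodule.span K {u}).comap T := by
    rw [Submodule.span_singleton_le_iff_mem, Submodule.mem_comap, hμ]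
    exact Submodule.smul_mem _ _ (Submodule.mem_span_singleton_self u)
  -- `T` is scalar modulo the line of `u`
  obtain ⟨ν, hν⟩ := LinearMap.exists_eq_smul_id_of_forall_notLinearIndependent
    (f := (Submodule.span K {u}).mapQ (Submodule.span K {u}) T hinv) (by
      intro x hx
      obtain ⟨x, rfl⟩ := Submodule.mkQ_surjective _ x
      rw [LinearIndependent.pair_iff] at hx
      apply h u x μ hμ
      rw [linearIndependent_triple_iff]
      intro p q r hpqr
      have := hx p q (by
        have := congrArg (Submodule.span K {u}).mkQ hpqr
        have hu0 : (Submodule.span K {u}).mkQ u = 0 := by simp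
        simpa only [map_add, map_smul, hu0, smul_zero, add_zero, map_zero,
            Submodule.mkQ_apply, Submodule.mapQ_apply] using this)
      obtain ⟨rfl, rfl⟩ := this
      simpa [hu] using hpqr)
  have hmem : ∀ x, T x - ν • x ∈ Submodule.span K {u} := by
    intro x
    have := LinearMap.congr_fun hν ((Submodule.span K {u}).mkQ x)
    rw [← Submodule.Quotient.mk_eq_zero]
    simpa [sub_eq_zero] using this
  set E := LinearMap.ker (T - ν • (1 : Module.End K V)) with hE
  have hE2 : 2 ≤ Module.finrank K E := by
    have h1 := LinearMap.finrank_range_add_finrank_ker (T - ν • (1 : Module.End K V))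
    have h2 : LinearMap.range (T - ν • (1 : Module.End K V)) ≤ Submodule.span K {u} := by
      rintro _ ⟨x, rfl⟩
      simpa using hmem x
    have h3 := (Submodule.finrank_mono h2).trans (finrank_span_singleton hu).le
    rw [← hE] at h1
    omega
  -- the eigenspace `E` of `ν` lies in the plane `⟨v, T v⟩` and is therefore equal to it
  have hEle : E ≤ Submodule.span K {v, T v} := by
    intro w hw
    have hw' : T w = ν • w := by simpa [hE, sub_eq_zero] using hw
    by_contra hcon
    refine h w v ν hw' (hv.triple_of_pair fun x y hxy => hcon ?_)
    rw [Submodule.mem_span_pair]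
    exact ⟨x, y, hxy.symm⟩
  have hP : Module.finrank K (Submodule.span K {v, T v}) ≤ 2 := by
    have := finrank_range_le_card (R := K) ![v, T v]
    rwa [Set.finrank, Matrix.range_cons, Matrix.range_cons, Matrix.range_empty, Set.union_empty,
      Fintype.card_fin] at this
  have hEq := Submodule.eq_of_le_of_finrank_le hEle (hP.trans hE2)
  have hvE : v ∈ E := hEq ▸ Submodule.subset_span (by simp)
  have hv' : T v = ν • v := by simpa [hE, sub_eq_zero] using hvE
  rw [LinearIndependent.pair_iff] at hv
  have := hv (-ν) 1 (by rw [hv']; module)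
  exact one_ne_zero this.2

/-- For an eigenvector `u` independent of `v` and `T v`, either `v` or `v + u` serves: otherwise
the eigenvalue of `u` is also an eigenvalue of `T` on the plane `⟨v, T v⟩`, which does not
contain `u`. -/
lemma exists_linearIndependent_orbit_of_unique_eigenline (hV : 3 ≤ Module.finrank K V)
    (hT : ∃ v, LinearIndependent K ![v, T v]) (he : ∃ u : V, u ≠ 0 ∧ ∃ μ : K, T u = μ • u)
    (huniq : ∀ (u w : V) (μ ν : K), u ≠ 0 → T u = μ • u → T w = ν • w → ∃ c : K, w = c • u) :
    ∃ v, LinearIndependent K ![v, T v, T (T v)] := by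
  by_contra! h
  obtain ⟨u, v, μ, hu, hli⟩ := exists_eigenvector_linearIndependent hV hT he
  rw [linearIndependent_triple_iff] at hli
  have hu0 : u ≠ 0 := by
    rintro rfl
    exact one_ne_zero (hli 0 0 1 (by simp)).2.2
  have hv : LinearIndependent K ![v, T v] := by
    rw [LinearIndependent.pair_iff]
    intro x y hxy
    have := hli x y 0 (by simpa using hxy)
    exact ⟨this.1, this.2.1⟩
  have hw : LinearIndependent K ![v + u, T (v + u)] := by
    rw [LinearIndependent.pair_iff]
    intro x y hxy
    have := hli x y (x + y * μ) (by rw [← hxy, map_add, hu]; module)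
    exact ⟨this.1, this.2.1⟩
  obtain ⟨s, t, hst⟩ : ∃ s t : K, T (T v) = s • v + t • T v := by
    by_contra! hc
    exact h v (hv.triple_of_pair hc)
  obtain ⟨x, y, hxy⟩ : ∃ x y : K, T (T (v + u)) = x • (v + u) + y • T (v + u) := by
    by_contra! hc
    exact h _ (hw.triple_of_pair hc)
  simp only [map_add, hu, map_smul, hst] at hxy
  obtain ⟨h1, h2, h3⟩ := hli (s - x) (t - y) (μ * μ - x - y * μ)
    (by linear_combination (norm := module) hxy)
  have h4 : s = μ * μ - t * μ := by linear_combination h1 + h2 * μ - h3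
  -- `μ` is a root of the characteristic polynomial of `T` on `⟨v, T v⟩`, which has an eigenvector
  obtain ⟨c, hc⟩ := huniq u (T v - (t - μ) • v) μ μ hu0 hu (by
    rw [map_sub, map_smul, hst, h4]; module)
  exact one_ne_zero (hli (-(t - μ)) 1 (-c) (by linear_combination (norm := module) hc)).2.1

/-- For `w` outside the span of `v`, `T v`, `T² v`, either `w` or `w + T v` completes `v`. -/
lemma exists_linearIndependent_quadruple_of_orbit (hV : 4 ≤ Module.finrank K V)
    (hT : ∃ v, LinearIndependent K ![v, T v, T (T v)]) :
    ∃ v w, LinearIndependent K ![v, T v, w, T w] := by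
  obtain ⟨v, hv⟩ := hT
  obtain ⟨w, hw⟩ := exists_notMem_span_range (K := K) ![v, T v, T (T v)] (by omega)
  have hw' : ∀ x y z : K, w ≠ x • v + y • T v + z • T (T v) := by
    rintro x y z rfl
    apply hw
    have h0 : ∀ i, ![v, T v, T (T v)] i ∈ Submodule.span K (Set.range ![v, T v, T (T v)]) :=
      fun i => Submodule.subset_span ⟨i, rfl⟩
    exact add_mem (add_mem (Submodule.smul_mem _ _ (h0 0)) (Submodule.smul_mem _ _ (h0 1)))
      (Submodule.smul_mem _ _ (h0 2))
  rw [linearIndependent_triple_iff] at hv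
  have hv2 : LinearIndependent K ![v, T v] := by
    rw [LinearIndependent.pair_iff]
    intro x y hxy
    have := hv x y 0 (by simpa using hxy)
    exact ⟨this.1, this.2.1⟩
  by_contra! h
  have h1 : LinearIndependent K ![v, T v, w] :=
    hv2.triple_of_pair fun x y hxy => hw' x y 0 (by simpa using hxy)
  obtain ⟨x, y, z, hxyz⟩ : ∃ x y z : K, T w = x • v + y • T v + z • w := by
    by_contra! hc
    exact h v w (h1.quadruple_of_triple hc)
  have h2 : LinearIndependent K ![v, T v, w + T v] :=
    hv2.triple_of_pair fun x y hxy => hw' x (y - 1) 0 (by linear_combination (norm := module) hxy)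
  obtain ⟨x', y', z', hxyz'⟩ : ∃ x y z : K, T (w + T v) = x • v + y • T v + z • (w + T v) := by
    by_contra! hc
    exact h v (w + T v) (h2.quadruple_of_triple hc)
  rw [map_add, hxyz] at hxyz'
  by_cases hz : z = z'
  · subst hz
    exact one_ne_zero
      (hv (x - x') (y - y' - z) 1 (by linear_combination (norm := module) hxyz')).2.2
  · have hz' : z' - z ≠ 0 := fun h => hz (sub_eq_zero.1 h).symm
    apply hw' ((z' - z)⁻¹ * (x - x')) ((z' - z)⁻¹ * (y - y' - z')) ((z' - z)⁻¹)
    have : (z' - z) • w = (x - x') • v + (y - y' - z') • T v + T (T v) := by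
      linear_combination (norm := module) -hxyz'
    rw [← one_smul K w, ← inv_mul_cancel₀ hz', mul_smul, this]
    module

/-- All the planes `⟨v, T v⟩` are invariant here, and two distinct ones meet trivially because
there are no eigenlines. -/
lemma exists_linearIndependent_quadruple_of_no_eigenvector (hV : 3 ≤ Module.finrank K V)
    (hne : ∀ (u : V) (μ : K), T u = μ • u → u = 0)
    (hT : ¬ ∃ v, LinearIndependent K ![v, T v, T (T v)]) :
    ∃ v w, LinearIndependent K ![v, T v, w, T w] := by
  push Not at hT
  have hpair : ∀ v, v ≠ 0 → LinearIndependent K ![v, T v] := by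
    intro v hv
    rw [LinearIndependent.pair_iff' hv]
    exact fun a ha => hv (hne v a ha.symm)
  have hquad : ∀ v, v ≠ 0 → ∃ s t : K, T (T v) = s • v + t • T v := by
    intro v hv
    by_contra! hc
    exact hT v ((hpair v hv).triple_of_pair hc)
  have : Nontrivial V := Module.nontrivial_of_finrank_pos (R := K) (by omega)
  obtain ⟨v, hv⟩ := exists_ne (0 : V)
  obtain ⟨w, hw⟩ := exists_notMem_span_range (K := K) ![v, T v] (by omega)
  have hw' : ∀ x y : K, w ≠ x • v + y • T v := by
    rintro x y rfl
    apply hw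
    have h0 : ∀ i, ![v, T v] i ∈ Submodule.span K (Set.range ![v, T v]) :=
      fun i => Submodule.subset_span ⟨i, rfl⟩
    exact add_mem (Submodule.smul_mem _ _ (h0 0)) (Submodule.smul_mem _ _ (h0 1))
  have hw0 : w ≠ 0 := fun h => hw' 0 0 (by simpa using h)
  refine ⟨v, w, ((hpair v hv).triple_of_pair hw').quadruple_of_triple fun x y k hk => ?_⟩
  -- `p = T w - k w` lies in both invariant planes `⟨v, T v⟩` and `⟨w, T w⟩`
  obtain ⟨s, t, hst⟩ := hquad v hv
  obtain ⟨s', t', hst'⟩ := hquad w hw0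
  have hp : T w - k • w = x • v + y • T v := by rw [hk]; module
  have hTp : T (T w - k • w) = (y * s) • v + (x + y * t) • T v := by
    rw [hp, map_add, map_smul, map_smul, hst]; module
  have e : (s' + (t' - k) * k) • w = (y * s - (t' - k) * x) • v
      + (x + y * t - (t' - k) * y) • T v := by
    rw [map_sub, map_smul, hst', hk] at hTp
    linear_combination (norm := module) hTp
  by_cases hc : s' + (t' - k) * k = 0
  · have hz := hne (T w - k • w) (t' - k) (by
      rw [map_sub, map_smul, hst']
      have : s' = -((t' - k) * k) := eq_neg_of_add_eq_zero_left hc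
      rw [this]; module)
    exact hw0 (hne w k (sub_eq_zero.1 hz))
  · apply hw' ((s' + (t' - k) * k)⁻¹ * (y * s - (t' - k) * x))
      ((s' + (t' - k) * k)⁻¹ * (x + y * t - (t' - k) * y))
    rw [← one_smul K w, ← inv_mul_cancel₀ hc, mul_smul, e]
    module

end LinearPatterns

/-! ### Moving independent families by the special linear group -/

/-- Two linearly independent families of the same size are carried to each other, up to scalars,
by some element of the special linear group: the determinant is corrected on one vector. -/
lemma exists_specialLinearGroup_smul_eq {d : ℕ} {K ι : Type*} [Field K] [Finite ι] [Nonempty ι]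
    {v w : ι → Fin d → K} (hv : LinearIndependent K v) (hw : LinearIndependent K w) :
    ∃ g : Matrix.SpecialLinearGroup (Fin d) K, ∀ i, ∃ c : K, c ≠ 0 ∧ g • w i = c • v i := by
  classical
  obtain ⟨i₀⟩ := ‹Nonempty ι›
  obtain ⟨g₀, hg₀⟩ : ∃ g : (Fin d → K) ≃ₗ[K] (Fin d → K), ∀ i, g (w i) = v i := by
    have : FiniteDimensional K (Submodule.span K (Set.range w)) :=
      FiniteDimensional.span_of_finite K (Set.finite_range w)
    obtain ⟨g, hg⟩ := Submodule.exists_linearEquiv_restrict_eq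
      (hw.linearCombinationEquiv.symm ≪≫ₗ hv.linearCombinationEquiv)
    refine ⟨g, fun i => ?_⟩
    have h1 : ((hw.linearCombinationEquiv (Finsupp.single i 1) :
      Submodule.span K (Set.range w)) : Fin d → K) = w i := by simp
    rw [← h1, ← hg]
    simp
  obtain ⟨φ, hφ⟩ : ∃ φ : Module.Dual K (Fin d → K), ∀ i, φ (v i) = if i = i₀ then 1 else 0 := by
    obtain ⟨φ, hφ⟩ := LinearMap.exists_extend
      ((Finsupp.lapply i₀ : (ι →₀ K) →ₗ[K] K) ∘ₗ hv.repr)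
    refine ⟨φ, fun i => ?_⟩
    have h1 := LinearMap.congr_fun hφ ⟨v i, Submodule.subset_span ⟨i, rfl⟩⟩
    have h2 : hv.repr ⟨v i, Submodule.subset_span ⟨i, rfl⟩⟩ = Finsupp.single i 1 :=
      hv.repr_eq_single i _ rfl
    simp only [LinearMap.comp_apply, Submodule.subtype_apply, h2,
      Finsupp.lapply_apply] at h1
    rw [h1, Finsupp.single_apply]
  set δ : K := LinearMap.det (g₀ : (Fin d → K) →ₗ[K] (Fin d → K)) with hδ
  have hδ0 : δ ≠ 0 := (LinearEquiv.isUnit_det' g₀).ne_zero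
  set h := LinearMap.transvection φ ((δ⁻¹ - 1) • v i₀) with hh
  have hdet : LinearMap.det (h ∘ₗ g₀.toLinearMap) = 1 := by
    rw [LinearMap.det_comp, hh, LinearMap.transvection.det, map_smul, hφ, if_pos rfl, ← hδ]
    simp [hδ0]
  refine ⟨⟨LinearMap.toMatrix' (h ∘ₗ g₀.toLinearMap), by rw [LinearMap.det_toMatrix', hdet]⟩,
    fun i => ⟨if i = i₀ then δ⁻¹ else 1, by split_ifs <;> simp [hδ0], ?_⟩⟩
  change Matrix.mulVec (LinearMap.toMatrix' (h ∘ₗ g₀.toLinearMap)) (w i) = _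
  rw [LinearMap.toMatrix'_mulVec, LinearMap.comp_apply, LinearEquiv.coe_coe, hg₀, hh,
    LinearMap.transvection.apply, hφ]
  split_ifs with hi
  · subst hi; module
  · simp

/-! ### Producing fixed lines of products -/

section FixedLines

open MulAction

variable {d : ℕ} {K : Type*} [Field K]

local notation "SLd" => Matrix.SpecialLinearGroup (Fin d) K
local notation "lin" => DistribSMul.toLinearMap K (Fin d → K)

/-- The number of lines of `K^d` fixed by a matrix of determinant one. -/
noncomputable def fixCard (g : Matrix.SpecialLinearGroup (Fin d) K) : ℕ :=
  Nat.card (fixedBy (ℙ K (Fin d → K)) g)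

lemma numFixedOneSpaces_mk (g : Matrix.SpecialLinearGroup (Fin d) K) :
    numFixedOneSpaces (g : Matrix.ProjectiveSpecialLinearGroup (Fin d) K) = fixCard g := rfl

lemma fixCard_inv (g : SLd) : fixCard g⁻¹ = fixCard g := by
  rw [fixCard, fixedBy_inv, fixCard]

lemma fixCard_conj (g h : SLd) : fixCard (h * g * h⁻¹) = fixCard g := by
  refine Nat.card_congr ⟨fun x => ⟨h⁻¹ • x.1, ?_⟩, fun x => ⟨h • x.1, ?_⟩, ?_, ?_⟩
  · have := x.2
    rw [mem_fixedBy] at this ⊢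
    rw [eq_inv_smul_iff, ← mul_smul, ← mul_smul, this]
  · have := x.2
    rw [mem_fixedBy] at this ⊢
    rw [mul_smul, inv_smul_smul, mul_smul, this]
  · intro x; simp
  · intro x; simp

lemma mk_mem_fixedBy {g : SLd} {v : Fin d → K} (hv : v ≠ 0) :
    Projectivization.mk K v hv ∈ fixedBy (ℙ K (Fin d → K)) g ↔ ∃ μ : K, g • v = μ • v := by
  rw [mem_fixedBy, Projectivization.smul_mk, Projectivization.mk_eq_mk_iff']
  exact exists_congr fun μ => eq_comm

lemma exists_linearIndependent_of_not_mem_center {g : SLd} (hg : g ∉ Subgroup.center SLd) :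
    ∃ v : Fin d → K, LinearIndependent K ![v, g • v] := by
  rw [← Projectivization.SL_mulAction_ker, MonoidHom.mem_ker] at hg
  by_contra! h
  apply hg
  ext1 L
  induction L using Projectivization.ind with | _ v hv =>
  change g • Projectivization.mk K v hv = _
  have h1 := h v
  rw [LinearIndependent.pair_iff' hv] at h1
  push Not at h1
  obtain ⟨μ, hμ⟩ := h1
  exact (mk_mem_fixedBy hv).2 ⟨μ, hμ.symm⟩

/-- If `g` moves the lines of `w` and `b w` to the lines of `v` and `a⁻¹ v`, then `a g b g⁻¹`
fixes the line of `v`. -/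
lemma exists_mul_conj_smul_eq {a b g : SLd} {v w : Fin d → K}
    (h1 : ∃ c : K, c ≠ 0 ∧ g • w = c • v) (h2 : ∃ c : K, g • b • w = c • a⁻¹ • v) :
    ∃ μ : K, (a * (g * b * g⁻¹)) • v = μ • v := by
  obtain ⟨c, hc, h1⟩ := h1
  obtain ⟨c', h2⟩ := h2
  have hv : v = c⁻¹ • g • w := by rw [h1, inv_smul_smul₀ hc]
  refine ⟨c⁻¹ * c', ?_⟩
  have : (a * (g * b * g⁻¹)) • v = c⁻¹ • a • g • b • w := by
    conv_lhs => rw [hv]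
    rw [smul_comm, mul_smul, mul_smul, mul_smul, inv_smul_smul]
  rw [this, h2, smul_comm a c', smul_inv_smul, smul_smul]

lemma fixCard_pos_of_eigenvector [Finite K] {g : SLd} {v : Fin d → K} (hv : v ≠ 0)
    (h : ∃ μ : K, g • v = μ • v) : 1 ≤ fixCard g := by
  have : Nonempty (fixedBy (ℙ K (Fin d → K)) g) := ⟨⟨_, (mk_mem_fixedBy hv).2 h⟩⟩
  exact Nat.card_pos

lemma two_le_fixCard [Finite K] {g : SLd} {v w : Fin d → K} (hvw : LinearIndependent K ![v, w])
    (hv : ∃ μ : K, g • v = μ • v) (hw : ∃ μ : K, g • w = μ • w) : 2 ≤ fixCard g := by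
  have hv0 : v ≠ 0 := hvw.ne_zero 0
  have hw0 : w ≠ 0 := hvw.ne_zero 1
  have : Nontrivial (fixedBy (ℙ K (Fin d → K)) g) := by
    refine ⟨⟨⟨_, (mk_mem_fixedBy hv0).2 hv⟩, ⟨_, (mk_mem_fixedBy hw0).2 hw⟩, ?_⟩⟩
    intro h
    rw [Subtype.mk.injEq, Projectivization.mk_eq_mk_iff'] at h
    obtain ⟨c, hc⟩ := h
    rw [LinearIndependent.pair_iff] at hvw
    have := hvw 1 (-c) (by rw [← hc]; module)
    exact one_ne_zero this.1
  exact Finite.one_lt_card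

lemma exists_one_le_fixCard [Finite K] {a b : SLd} (ha : a ∉ Subgroup.center SLd)
    (hb : b ∉ Subgroup.center SLd) : ∃ g : SLd, 1 ≤ fixCard (a * (g * b * g⁻¹)) := by
  obtain ⟨v, hv⟩ := exists_linearIndependent_of_not_mem_center
    (mt (Subgroup.inv_mem_iff (Subgroup.center SLd)).1 ha)
  obtain ⟨w, hw⟩ := exists_linearIndependent_of_not_mem_center hb
  obtain ⟨g, hg⟩ := exists_specialLinearGroup_smul_eq hv hw
  obtain ⟨c, -, hc⟩ := hg 1
  exact ⟨g, fixCard_pos_of_eigenvector (hv.ne_zero 0) (exists_mul_conj_smul_eq (hg 0) ⟨c, hc⟩)⟩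

lemma exists_eigenvector_of_fixCard_pos {g : SLd} (h : 1 ≤ fixCard g) :
    ∃ v : Fin d → K, v ≠ 0 ∧ ∃ μ : K, g • v = μ • v := by
  obtain ⟨L, hL⟩ := (Nat.card_pos_iff.1 h).1
  induction L using Projectivization.ind with | _ v hv =>
  exact ⟨v, hv, (mk_mem_fixedBy hv).1 hL⟩

lemma exists_two_le_fixCard_of_triple [Finite K] {a b : SLd}
    (ha : ∃ v : Fin d → K, LinearIndependent K ![v, a⁻¹ • v, a⁻¹ • a⁻¹ • v])
    (hb : ∃ w : Fin d → K, LinearIndependent K ![w, b • w, b • b • w]) :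
    ∃ g : SLd, 2 ≤ fixCard (a * (g * b * g⁻¹)) := by
  obtain ⟨v, hv⟩ := ha
  obtain ⟨w, hw⟩ := hb
  obtain ⟨g, hg⟩ := exists_specialLinearGroup_smul_eq hv hw
  have h2 : LinearIndependent K ![v, a⁻¹ • v] := by
    rw [linearIndependent_triple_iff] at hv
    rw [LinearIndependent.pair_iff]
    intro x y hxy
    have := hv x y 0 (by simpa using hxy)
    exact ⟨this.1, this.2.1⟩
  obtain ⟨c, -, hc⟩ := hg 1
  obtain ⟨c', -, hc'⟩ := hg 2
  exact ⟨g, two_le_fixCard h2 (exists_mul_conj_smul_eq (hg 0) ⟨c, hc⟩)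
    (exists_mul_conj_smul_eq (hg 1) ⟨c', hc'⟩)⟩

lemma exists_two_le_fixCard_of_quadruple [Finite K] {a b : SLd}
    (ha : ∃ v v' : Fin d → K, LinearIndependent K ![v, a⁻¹ • v, v', a⁻¹ • v'])
    (hb : ∃ w w' : Fin d → K, LinearIndependent K ![w, b • w, w', b • w']) :
    ∃ g : SLd, 2 ≤ fixCard (a * (g * b * g⁻¹)) := by
  obtain ⟨v, v', hv⟩ := ha
  obtain ⟨w, w', hw⟩ := hb
  obtain ⟨g, hg⟩ := exists_specialLinearGroup_smul_eq hv hw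
  have h2 : LinearIndependent K ![v, v'] := by
    have := hv.comp ![0, 2] (by decide)
    convert this using 1
    ext i; fin_cases i <;> rfl
  obtain ⟨c, -, hc⟩ := hg 1
  obtain ⟨c', -, hc'⟩ := hg 3
  exact ⟨g, two_le_fixCard h2 (exists_mul_conj_smul_eq (hg 0) ⟨c, hc⟩)
    (exists_mul_conj_smul_eq (hg 2) ⟨c', hc'⟩)⟩

lemma exists_two_le_fixCard_of_eigenvector [Finite K] {a b : SLd}
    (ha : ∃ (u v : Fin d → K) (μ : K), a⁻¹ • u = μ • u ∧ LinearIndependent K ![v, a⁻¹ • v, u])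
    (hb : ∃ (u v : Fin d → K) (μ : K), b • u = μ • u ∧ LinearIndependent K ![v, b • v, u]) :
    ∃ g : SLd, 2 ≤ fixCard (a * (g * b * g⁻¹)) := by
  obtain ⟨u, v, μ, hu, hv⟩ := ha
  obtain ⟨x, w, ν, hx, hw⟩ := hb
  obtain ⟨g, hg⟩ := exists_specialLinearGroup_smul_eq hv hw
  have h2 : LinearIndependent K ![v, u] := by
    have := hv.comp ![0, 2] (by decide)
    convert this using 1
    ext i; fin_cases i <;> rfl
  have hμ : μ ≠ 0 := by
    rintro rfl
    rw [zero_smul, smul_eq_zero_iff_eq] at hu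
    exact hv.ne_zero 2 hu
  obtain ⟨c, -, hc⟩ := hg 1
  obtain ⟨c', -, hc'⟩ := hg 2
  refine ⟨g, two_le_fixCard h2 (exists_mul_conj_smul_eq (hg 0) ⟨c, hc⟩)
    (exists_mul_conj_smul_eq (hg 2) ⟨ν * c' * μ⁻¹, ?_⟩)⟩
  change g • x = c' • u at hc'
  change g • b • x = _ • a⁻¹ • u
  rw [hx, hu, smul_comm, hc', smul_smul, smul_smul, inv_mul_cancel_right₀ hμ]

/-- In dimension at least three, if `a` fixes only one line, then `a⁻¹` admits each of the
configurations of vectors that can be needed to match one of `b`. -/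
theorem exists_two_le_fixCard [Finite K] (hd : 3 ≤ d) {a b : SLd} (ha : a ∉ Subgroup.center SLd)
    (hb : b ∉ Subgroup.center SLd) (hfa : fixCard a = 1) :
    ∃ g : SLd, 2 ≤ fixCard (a * (g * b * g⁻¹)) := by
  have hV : 3 ≤ Module.finrank K (Fin d → K) := by simpa using hd
  have ha' := exists_linearIndependent_of_not_mem_center
    (mt (Subgroup.inv_mem_iff (Subgroup.center SLd)).1 ha)
  have hb' := exists_linearIndependent_of_not_mem_center hb
  have hfa' : fixCard a⁻¹ = 1 := (fixCard_inv a).trans hfa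
  have hea := exists_eigenvector_of_fixCard_pos hfa'.ge
  by_cases hfb : 1 ≤ fixCard b
  · exact exists_two_le_fixCard_of_eigenvector
      (exists_eigenvector_linearIndependent (T := lin a⁻¹) hV ha' hea)
      (exists_eigenvector_linearIndependent (T := lin b) hV hb'
        (exists_eigenvector_of_fixCard_pos hfb))
  · have ha3 := exists_linearIndependent_orbit_of_unique_eigenline (T := lin a⁻¹) hV ha' hea (by
      intro u w μ ν hu hμ hν
      by_contra! hc
      have h2 : LinearIndependent K ![u, w] := by
        rw [LinearIndependent.pair_iff' hu]
        exact fun c h => hc c h.symm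
      have := two_le_fixCard (g := a⁻¹) h2 ⟨μ, hμ⟩ ⟨ν, hν⟩
      omega)
    by_cases hb3 : ∃ w : Fin d → K, LinearIndependent K ![w, b • w, b • b • w]
    · exact exists_two_le_fixCard_of_triple ha3 hb3
    · have hb4 := exists_linearIndependent_quadruple_of_no_eigenvector (T := lin b) hV (by
        intro u μ hμ
        by_contra hu
        exact hfb (fixCard_pos_of_eigenvector hu ⟨μ, hμ⟩)) hb3
      have hd4 : 4 ≤ Module.finrank K (Fin d → K) := by
        obtain ⟨v, w, h⟩ := hb4
        simpa using h.fintype_card_le_finrank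
      have ha4 := exists_linearIndependent_quadruple_of_orbit (T := lin a⁻¹) hd4 ha3
      exact exists_two_le_fixCard_of_quadruple ha4 hb4

end FixedLines

/-! ### Eigenspaces and the number of fixed lines -/

section Bounds

/-- The number `1 + q + ⋯ + q^(n-1)` of points of the projective space of `K^n`, for `q = |K|`. -/
noncomputable def numPoints (K : Type*) (n : ℕ) : ℕ := ∑ i ∈ Finset.range n, Nat.card K ^ i

lemma numPoints_add (K : Type*) (m n : ℕ) :
    numPoints K (m + n) = numPoints K m + Nat.card K ^ m * numPoints K n := by
  rw [numPoints, Finset.sum_range_add, numPoints, numPoints, Finset.mul_sum]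
  simp [pow_add]

lemma numPoints_mono (K : Type*) : Monotone (numPoints K) := fun m n h => by
  obtain ⟨k, rfl⟩ := Nat.exists_eq_add_of_le h
  rw [numPoints_add]
  omega

lemma numPoints_zero (K : Type*) : numPoints K 0 = 0 := by simp [numPoints]

lemma numPoints_one (K : Type*) : numPoints K 1 = 1 := by simp [numPoints]

/-- Subspaces of dimensions `x ≥ 1` and `y` with `x + y ≤ n + 1` have the most points in total, for
`x ≤ n`, when one of them is an `n`-space and the other is a point. -/
lemma numPoints_add_le (K : Type*) [Finite K] [Nonempty K] {x y n : ℕ} (hx : 1 ≤ x)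
    (hxn : x ≤ n) (hxy : x + y ≤ n + 1) :
    numPoints K x + numPoints K y ≤ numPoints K n + 1 := by
  obtain _ | y := y
  · rw [numPoints_zero]
    have := numPoints_mono K hxn
    omega
  have h1 : numPoints K (x + y) ≤ numPoints K n := numPoints_mono K (by omega)
  rw [numPoints_add] at h1
  rw [add_comm y 1, numPoints_add, numPoints_one]
  have h2 : Nat.card K ^ 1 * numPoints K y ≤ Nat.card K ^ x * numPoints K y :=
    Nat.mul_le_mul_right _ (Nat.pow_le_pow_right Nat.card_pos hx)
  omega

open MulAction Module

variable {d : ℕ} {K : Type*} [Field K]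

local notation "SLd" => Matrix.SpecialLinearGroup (Fin d) K
local notation "lin" => DistribSMul.toLinearMap K (Fin d → K)

/-- The lines of `K^d` contained in a subspace. -/
def linesIn (W : Submodule K (Fin d → K)) : Set (ℙ K (Fin d → K)) :=
  Set.range (Projectivization.map W.subtype W.injective_subtype)

lemma mk_mem_linesIn {W : Submodule K (Fin d → K)} {v : Fin d → K} (hv : v ≠ 0) :
    Projectivization.mk K v hv ∈ linesIn W ↔ v ∈ W := by
  constructor
  · rintro ⟨L, hL⟩
    induction L using Projectivization.ind with | _ w hw =>
    rw [Projectivization.map_mk, Projectivization.mk_eq_mk_iff'] at hL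
    obtain ⟨c, hc⟩ := hL
    have hc0 : c ≠ 0 := by
      rintro rfl
      apply hw
      ext1
      simpa using hc.symm
    rw [← W.smul_mem_iff hc0, hc]
    exact w.2
  · intro hvW
    exact ⟨Projectivization.mk K ⟨v, hvW⟩ fun h => hv (congrArg Subtype.val h),
      Projectivization.map_mk ..⟩

lemma ncard_linesIn [Finite K] (W : Submodule K (Fin d → K)) :
    (linesIn W).ncard = numPoints K (finrank K W) := by
  rw [linesIn, Set.ncard_range_of_injective (Projectivization.map_injective _ _),
    Projectivization.card_of_finrank K W rfl, numPoints]

lemma fixCard_eq_ncard (g : SLd) : fixCard g = (fixedBy (ℙ K (Fin d → K)) g).ncard := rfl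

lemma numPoints_le_fixCard [Finite K] {g : SLd} (W : Submodule K (Fin d → K))
    (h : ∀ v ∈ W, ∃ μ : K, g • v = μ • v) : numPoints K (finrank K W) ≤ fixCard g := by
  rw [← ncard_linesIn, fixCard_eq_ncard]
  refine Set.ncard_le_ncard ?_ (Set.toFinite _)
  intro L hL
  induction L using Projectivization.ind with | _ v hv =>
  exact (mk_mem_fixedBy hv).2 (h v ((mk_mem_linesIn hv).1 hL))

lemma mem_eigenspace_lin {g : SLd} {μ : K} {v : Fin d → K} :
    v ∈ End.eigenspace (lin g) μ ↔ g • v = μ • v := End.mem_eigenspace_iff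

lemma ne_zero_of_smul_eq {g : SLd} {μ : K} {v : Fin d → K} (hv : v ≠ 0) (h : g • v = μ • v) :
    μ ≠ 0 := by
  rintro rfl
  rw [zero_smul, smul_eq_zero_iff_eq] at h
  exact hv h

/-- There are at most `q - 1` eigenvalues, as zero is not one of them. -/
lemma fixCard_le_of_finrank_eigenspace_le [Finite K] {g : SLd} {n : ℕ}
    (h : ∀ μ : K, finrank K (End.eigenspace (lin g) μ) ≤ n) :
    fixCard g ≤ (Nat.card K - 1) * numPoints K n := by
  have := Fintype.ofFinite Kˣ
  have hsub : fixedBy (ℙ K (Fin d → K)) g ⊆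
      ⋃ μ : Kˣ, linesIn (End.eigenspace (lin g) (μ : K)) := by
    intro L hL
    induction L using Projectivization.ind with | _ v hv =>
    obtain ⟨μ, hμ⟩ := (mk_mem_fixedBy hv).1 hL
    rw [Set.mem_iUnion]
    exact ⟨Units.mk0 μ (ne_zero_of_smul_eq hv hμ), (mk_mem_linesIn hv).2
      (mem_eigenspace_lin.2 hμ)⟩
  rw [fixCard_eq_ncard]
  refine (Set.ncard_le_ncard hsub (Set.toFinite _)).trans
    ((Set.ncard_iUnion_le_of_fintype _).trans ?_)
  refine (Finset.sum_le_card_nsmul _ _ (numPoints K n) fun μ _ => ?_).trans ?_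
  · rw [ncard_linesIn]
    exact numPoints_mono K (h μ)
  · rw [Finset.card_univ, ← Nat.card_eq_fintype_card, Nat.card_units, smul_eq_mul]

/-- An eigenspace and the sum of the remaining ones are independent and contain all fixed
lines. -/
lemma fixCard_le_of_not_mem_center [Finite K] {g : SLd} (hg : g ∉ Subgroup.center SLd) :
    fixCard g ≤ numPoints K (d - 1) + 1 := by
  by_cases hpos : 1 ≤ fixCard g
  swap
  · omega
  obtain ⟨v, hv, lam, hlam⟩ := exists_eigenvector_of_fixCard_pos hpos
  set E := End.eigenspace (lin g) lam with hE
  set C := ⨆ μ : K, ⨆ _ : μ ≠ lam, End.eigenspace (lin g) μ with hC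
  have hsub : fixedBy (ℙ K (Fin d → K)) g ⊆ linesIn E ∪ linesIn C := by
    intro L hL
    induction L using Projectivization.ind with | _ w hw =>
    obtain ⟨μ, hμ⟩ := (mk_mem_fixedBy hw).1 hL
    by_cases h : μ = lam
    · subst h
      exact Or.inl ((mk_mem_linesIn hw).2 (mem_eigenspace_lin.2 hμ))
    · refine Or.inr ((mk_mem_linesIn hw).2 ?_)
      exact Submodule.mem_iSup_of_mem μ
        (Submodule.mem_iSup_of_mem h (mem_eigenspace_lin.2 hμ))
  have hle : fixCard g ≤ numPoints K (finrank K E) + numPoints K (finrank K C) := by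
    rw [← ncard_linesIn, ← ncard_linesIn, fixCard_eq_ncard]
    exact (Set.ncard_le_ncard hsub (Set.toFinite _)).trans (Set.ncard_union_le _ _)
  have hdisj : Disjoint E C := End.eigenspaces_iSupIndep (lin g) lam
  have hd : finrank K E + finrank K C ≤ d := by
    have h1 := Submodule.finrank_sup_add_finrank_inf_eq E C
    rw [hdisj.eq_bot, finrank_bot] at h1
    have h2 := Submodule.finrank_le (E ⊔ C)
    rw [finrank_fin_fun] at h2
    omega
  have hE1 : 1 ≤ finrank K E := by
    rw [Submodule.one_le_finrank_iff]
    intro hbot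
    have : v ∈ E := mem_eigenspace_lin.2 hlam
    rw [hbot, Submodule.mem_bot] at this
    exact hv this
  have hEd : finrank K E ≠ d := by
    intro h
    have htop : E = ⊤ := Submodule.eq_top_of_finrank_eq (by rw [h, finrank_fin_fun])
    obtain ⟨w, hw⟩ := exists_linearIndependent_of_not_mem_center hg
    have hwE : w ∈ E := htop ▸ Submodule.mem_top
    rw [LinearIndependent.pair_iff] at hw
    exact one_ne_zero (hw (-lam) 1 (by rw [mem_eigenspace_lin.1 hwE]; module)).2
  exact hle.trans (numPoints_add_le K hE1 (by omega) (by omega))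

/-- If `g` moves an eigenspace of `b` into one of `a`, then `a g b g⁻¹` is scalar on the image. -/
lemma exists_numPoints_le_fixCard [Finite K] {a b : SLd} {lam μ : K}
    (hμ : 1 ≤ finrank K (End.eigenspace (lin b) μ))
    (h : finrank K (End.eigenspace (lin b) μ) ≤ finrank K (End.eigenspace (lin a) lam)) :
    ∃ g : SLd, numPoints K (finrank K (End.eigenspace (lin b) μ)) ≤
      fixCard (a * (g * b * g⁻¹)) := by
  set F := End.eigenspace (lin b) μ with hF
  set E := End.eigenspace (lin a) lam with hE
  have : Nonempty (Fin (finrank K F)) := ⟨⟨0, hμ⟩⟩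
  have hw := (finBasis K F).linearIndependent.map' F.subtype (Submodule.ker_subtype F)
  have hv := ((finBasis K E).linearIndependent.map' E.subtype (Submodule.ker_subtype E)).comp
    (Fin.castLE h) (Fin.castLE_injective h)
  obtain ⟨g, hg⟩ := exists_specialLinearGroup_smul_eq hv hw
  have hmap : F.map (lin g) ≤ E := by
    rw [Submodule.map_le_iff_le_comap]
    have hspan : F = Submodule.span K (Set.range (F.subtype ∘ finBasis K F)) := by
      rw [Set.range_comp, Submodule.span_image, (finBasis K F).span_eq, Submodule.map_top,
        Submodule.range_subtype]
    rw [hspan, Submodule.span_le]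
    rintro _ ⟨i, rfl⟩
    obtain ⟨c, -, hc⟩ := hg i
    change g • (F.subtype ∘ finBasis K F) i ∈ E
    rw [hc]
    exact Submodule.smul_mem _ _ (Subtype.mem _)
  refine ⟨g, ?_⟩
  have hinj : Function.Injective (lin g) := MulAction.injective g
  rw [(Submodule.equivMapOfInjective (lin g) hinj F).finrank_eq]
  apply numPoints_le_fixCard
  rintro _ ⟨u, hu, rfl⟩
  have hguE := hmap ⟨u, hu, rfl⟩
  change ∃ ν : K, (a * (g * b * g⁻¹)) • g • u = ν • g • u
  refine ⟨μ * lam, ?_⟩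
  rw [mul_smul, mul_smul, mul_smul, inv_smul_smul, mem_eigenspace_lin.1 hu, smul_comm g μ,
    smul_comm a μ, show a • g • u = lam • g • u from mem_eigenspace_lin.1 hguE, smul_smul]

end Bounds

/-! ### The product formula for fixed lines -/

section Contradiction

open MulAction Module

variable {d : ℕ} {K : Type*} [Field K]

local notation "SLd" => Matrix.SpecialLinearGroup (Fin d) K
local notation "lin" => DistribSMul.toLinearMap K (Fin d → K)

lemma fixCard_mul_conj_comm (a b g : SLd) :
    fixCard (b * (g * a * g⁻¹)) = fixCard (a * (g⁻¹ * b * g⁻¹⁻¹)) := by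
  rw [← fixCard_conj (a * (g⁻¹ * b * g⁻¹⁻¹)) (g * a⁻¹)]
  congr 1
  group

lemma card_projectivization [Finite K] (hd : 1 ≤ d) :
    Nat.card (ℙ K (Fin d → K)) = 1 + Nat.card K * numPoints K (d - 1) := by
  rw [Projectivization.card_of_finrank K _ (finrank_fin_fun K)]
  change numPoints K d = _
  conv_lhs => rw [← Nat.add_sub_cancel' hd]
  rw [numPoints_add, numPoints_one, pow_one]

lemma one_le_numPoints (K : Type*) {n : ℕ} (hn : 1 ≤ n) : 1 ≤ numPoints K n := by
  rw [← numPoints_one K]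
  exact numPoints_mono K hn

theorem fixCard_mul_conj_formula [Finite K] (hd : 2 ≤ d) {a b : SLd} {c : ℕ}
    (hc : ∀ g : SLd, fixCard (a * (g * b * g⁻¹)) = c) :
    ((Nat.card K : ℤ) * numPoints K (d - 1)) * (c - 1) =
      ((fixCard a : ℤ) - 1) * (fixCard b - 1) := by
  have hM : 1 ≤ numPoints K (d - 1) := one_le_numPoints K (by omega)
  have hq : 1 < Nat.card K := Finite.one_lt_card
  have h1 := card_projectivization (K := K) (d := d) (by omega)
  have h := card_fixedBy_mul_conj (X := ℙ K (Fin d → K)) (by rw [h1]; nlinarith) a b c hc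
  rw [h1] at h
  push_cast at h
  rwa [add_sub_cancel_left] at h

/-- A constant value `c ≥ 2` is incompatible with the product formula: if the largest eigenspace
of `b`, of dimension `β`, is at most as large as that of `a`, some product fixes all lines of
a subspace of dimension `β`, whereas the bounds on `f(a)` and `f(b)` force `c` to be smaller. -/
theorem not_two_le_of_fixCard_mul_conj_eq [Finite K] (hd : 2 ≤ d) {a b : SLd}
    (ha : a ∉ Subgroup.center SLd) (hb : b ∉ Subgroup.center SLd) {c : ℕ}
    (hc : ∀ g : SLd, fixCard (a * (g * b * g⁻¹)) = c) : ¬ 2 ≤ c := by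
  intro hc2
  obtain ⟨lam, hlam⟩ := Finite.exists_max fun μ : K => finrank K (End.eigenspace (lin a) μ)
  obtain ⟨μ, hμ⟩ := Finite.exists_max fun μ : K => finrank K (End.eigenspace (lin b) μ)
  wlog hle : finrank K (End.eigenspace (lin b) μ) ≤ finrank K (End.eigenspace (lin a) lam)
    generalizing a b lam μ
  · exact this hb ha (fun g => (fixCard_mul_conj_comm a b g).trans (hc g⁻¹)) μ hμ lam hlam
      (le_of_not_ge hle)
  have hform := fixCard_mul_conj_formula hd hc
  have hA := fixCard_le_of_not_mem_center ha
  have hB := fixCard_le_of_finrank_eigenspace_le hμ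
  have hM : 1 ≤ numPoints K (d - 1) := one_le_numPoints K (by omega)
  have hq : 1 < Nat.card K := Finite.one_lt_card
  have hqM : 2 ≤ (Nat.card K : ℤ) * numPoints K (d - 1) * (c - 1) := by
    have h1 : 2 * 1 ≤ Nat.card K * numPoints K (d - 1) := Nat.mul_le_mul hq hM
    zify at h1 hc2
    nlinarith
  -- if `f(a) = 0`, the product formula would make `f(b)` negative, and conversely
  have hA1 : 1 ≤ fixCard a := by
    by_contra h
    have h0 : fixCard a = 0 := by omega
    rw [h0] at hform
    push_cast at hform
    linarith
  have hB1 : 1 ≤ fixCard b := by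
    by_contra h
    have h0 : fixCard b = 0 := by omega
    rw [h0] at hform
    push_cast at hform
    linarith
  have hβ : 1 ≤ finrank K (End.eigenspace (lin b) μ) := by
    by_contra h
    have h0 : finrank K (End.eigenspace (lin b) μ) = 0 := by omega
    rw [h0, numPoints_zero] at hB
    omega
  obtain ⟨g, hg⟩ := exists_numPoints_le_fixCard hβ hle
  rw [hc g] at hg
  generalize finrank K (End.eigenspace (lin b) μ) = β at *
  zify [hq.le] at *
  generalize (numPoints K (d - 1) : ℤ) = M at *
  -- `q (N_β - 1) ≤ q (c - 1) ≤ f(b) - 1 ≤ (q - 1) N_β - 1` forces `N_β ≤ q - 1`, so `β = 1`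
  have h1 : (Nat.card K : ℤ) * (c - 1) ≤ fixCard b - 1 := by
    refine le_of_mul_le_mul_left ?_ (by linarith : 0 < M)
    calc M * ((Nat.card K : ℤ) * (c - 1)) = ((fixCard a : ℤ) - 1) * (fixCard b - 1) := by
          rw [← hform]; ring
      _ ≤ M * (fixCard b - 1) := mul_le_mul_of_nonneg_right (by linarith) (by linarith)
  have h2 : (numPoints K β : ℤ) ≤ Nat.card K - 1 := by
    have : (Nat.card K : ℤ) * (numPoints K β - 1) ≤ Nat.card K * (c - 1) :=
      mul_le_mul_of_nonneg_left (by linarith) (by linarith)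
    linarith
  have h3 : numPoints K β = 1 := by
    obtain rfl | h : β = 1 ∨ 1 + 1 ≤ β := by omega
    · exact numPoints_one K
    · have := numPoints_mono K h
      rw [numPoints_add, numPoints_one, pow_one, mul_one] at this
      omega
  rw [h3] at hB
  push_cast at hB
  nlinarith

end Contradiction

/-! ### Dimension two -/

section DimensionTwo

open MulAction Module

variable {K : Type*} [Field K]

local notation "SL2" => Matrix.SpecialLinearGroup (Fin 2) K

lemma sl_two_smul_apply (m : SL2) (v : Fin 2 → K) (i : Fin 2) :
    (m • v) i = m.1 i 0 * v 0 + m.1 i 1 * v 1 := by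
  change (Matrix.mulVec m.1 v) i = _
  rw [Matrix.mulVec, dotProduct, Fin.sum_univ_two]

lemma sl_two_smul_smul (m : SL2) (v : Fin 2 → K) : m • m • v = m.1.trace • m • v - v := by
  have hdet := m.2
  rw [Matrix.det_fin_two] at hdet
  ext i
  fin_cases i <;>
  simp only [sl_two_smul_apply, Pi.sub_apply, Pi.smul_apply, Matrix.trace_fin_two, smul_eq_mul,
    Fin.zero_eta, Fin.mk_one]
  · linear_combination (-v 0) * hdet
  · linear_combination (-v 1) * hdet

/-- An eigenvalue `lam` and the other root `lam⁻¹` of the characteristic polynomial coincide: if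
they were distinct, there would be two fixed lines. -/
lemma trace_sq_eq_four_of_fixCard_eq_one [Finite K] {m : SL2} (h : fixCard m = 1) :
    m.1.trace ^ 2 = 4 ∧ ∀ (u : Fin 2 → K) (lam : K), u ≠ 0 → m • u = lam • u → lam ^ 2 = 1 := by
  have hall : ∀ (u : Fin 2 → K) (lam : K), u ≠ 0 → m • u = lam • u →
      lam ^ 2 = 1 ∧ m.1.trace = 2 * lam := by
    intro u lam hu hlam
    have hlam0 := ne_zero_of_smul_eq hu hlam
    have hchar : m.1.trace = lam + lam⁻¹ := by
      have h1 := sl_two_smul_smul m u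
      rw [hlam, smul_comm m lam, hlam, smul_smul, smul_smul] at h1
      have h2 : (lam * lam - m.1.trace * lam + 1) • u = 0 := by
        linear_combination (norm := module) h1
      have h3 := (smul_eq_zero.1 h2).resolve_right hu
      field_simp
      linear_combination -h3
    suffices lam = lam⁻¹ by
      rw [← this] at hchar
      refine ⟨?_, by rw [hchar]; ring⟩
      rw [sq]
      nth_rewrite 2 [this]
      exact mul_inv_cancel₀ hlam0
    by_cases hm : m ∈ Subgroup.center SL2
    · obtain ⟨r, hr, hrm⟩ := Matrix.SpecialLinearGroup.mem_center_iff.1 hm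
      rw [← hrm] at hchar
      simp only [Matrix.scalar_apply, Matrix.trace_fin_two, Matrix.diagonal_apply_eq] at hchar
      have hru : m • u = r • u := by
        ext i
        rw [sl_two_smul_apply, ← hrm]
        fin_cases i <;> simp
      have : lam = r := by
        rw [hlam] at hru
        exact smul_left_injective K hu hru
      subst this
      linear_combination hchar
    · by_contra hne
      obtain ⟨v, hv⟩ := exists_linearIndependent_of_not_mem_center hm
      have hw : m • (m • v - lam • v) = lam⁻¹ • (m • v - lam • v) := by
        rw [smul_sub, sl_two_smul_smul, hchar, smul_comm m lam, smul_sub, smul_smul,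
          inv_mul_cancel₀ hlam0]
        generalize m • v = x
        module
      have hw0 : m • v - lam • v ≠ 0 := by
        intro h0
        rw [LinearIndependent.pair_iff] at hv
        exact one_ne_zero (hv (-lam) 1 (by rw [neg_smul, one_smul, neg_add_eq_sub, h0])).2
      have hli : LinearIndependent K ![u, m • v - lam • v] := by
        rw [LinearIndependent.pair_iff' hu]
        intro c hc
        rw [← hc, smul_comm m c, hlam, smul_comm c lam, ← sub_eq_zero, ← sub_smul] at hw
        rw [hc] at hw
        exact hne (sub_eq_zero.1 ((smul_eq_zero.1 hw).resolve_right hw0))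
      have := two_le_fixCard hli ⟨lam, hlam⟩ ⟨lam⁻¹, hw⟩
      omega
  obtain ⟨u, hu, lam, hlam⟩ := exists_eigenvector_of_fixCard_pos h.ge
  obtain ⟨h1, h2⟩ := hall u lam hu hlam
  refine ⟨?_, fun u lam hu hlam => (hall u lam hu hlam).1⟩
  rw [h2]
  linear_combination 4 * h1

/-- Over a field with at least four elements a quadratic polynomial cannot take only the values
`2` and `-2`: for `q ≥ 5` it takes each of them at most twice, and for `q = 4` they are equal. -/
lemma exists_quadratic_sq_ne_four [Finite K] (hq : 4 ≤ Nat.card K) {α β γ : K} (hγ : γ ≠ 0) :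
    ∃ r : K, (α + β * r + γ * r ^ 2) ^ 2 ≠ 4 := by
  have := Fintype.ofFinite K
  rw [Nat.card_eq_fintype_card] at hq
  by_contra! h
  open Polynomial in
  by_cases h2 : (2 : K) = 0
  · have hdeg : (C γ * X ^ 2 + C β * X + C α : K[X]).natDegree = 2 :=
      natDegree_quadratic hγ
    have hp := eq_zero_of_natDegree_lt_card_of_eval_eq_zero'
      (C γ * X ^ 2 + C β * X + C α : K[X]) Finset.univ (fun r _ => by
        have h4 : (4 : K) = 0 := by linear_combination 2 * h2
        have := h r
        rw [h4] at this
        have := pow_eq_zero_iff (two_ne_zero) |>.1 this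
        simp only [eval_add, eval_mul, eval_C, eval_pow, eval_X]
        linear_combination this) (by rw [hdeg, Finset.card_univ]; omega)
    rw [hp] at hdeg
    simp at hdeg
  · have hq4 : Fintype.card K ≠ 4 := by
      intro h4
      have hc : ((Fintype.card K : ℕ) : K) = 0 := Nat.cast_card_eq_zero K
      rw [h4] at hc
      push_cast at hc
      have : (2 : K) * 2 = 0 := by linear_combination hc
      exact h2 (mul_self_eq_zero.1 this)
    have hdeg : ((C γ * X ^ 2 + C β * X + C α) ^ 2 - C 4 : K[X]).natDegree = 4 := by
      rw [natDegree_sub_C, natDegree_pow, natDegree_quadratic hγ]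
    have hp := eq_zero_of_natDegree_lt_card_of_eval_eq_zero'
      ((C γ * X ^ 2 + C β * X + C α) ^ 2 - C 4 : K[X]) Finset.univ (fun r _ => by
        simp only [eval_add, eval_mul, eval_C, eval_pow, eval_X, eval_sub]
        linear_combination h r) (by rw [hdeg, Finset.card_univ]; omega)
    rw [hp] at hdeg
    simp at hdeg

/-- After conjugation `a` is upper triangular, and the trace of the product of `a` with the
conjugate of `b` by a lower unitriangular matrix is a quadratic polynomial in the parameter. -/
theorem exists_fixCard_ne_one_of_dim_two [Finite K] (hq : 4 ≤ Nat.card K) {a b : SL2}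
    (ha : a ∉ Subgroup.center SL2) (hb : b ∉ Subgroup.center SL2) (hfa : fixCard a = 1) :
    ∃ g : SL2, fixCard (a * (g * b * g⁻¹)) ≠ 1 := by
  by_contra! hone
  obtain ⟨u, hu, lam, hlam⟩ := exists_eigenvector_of_fixCard_pos hfa.ge
  have hlam2 := (trace_sq_eq_four_of_fixCard_eq_one hfa).2 u lam hu hlam
  have hsingle : ∀ i : Fin 2, LinearIndependent K fun _ : Unit => (Pi.single i 1 : Fin 2 → K) :=
    fun i => LinearIndependent.of_subsingleton () (by simp)
  obtain ⟨h, hh⟩ := exists_specialLinearGroup_smul_eq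
    (LinearIndependent.of_subsingleton (v := fun _ : Unit => u) () hu) (hsingle 0)
  obtain ⟨c, hc, hh⟩ := hh ()
  obtain ⟨v, hv⟩ := exists_linearIndependent_of_not_mem_center hb
  obtain ⟨k, hk⟩ := exists_specialLinearGroup_smul_eq
    (LinearIndependent.of_subsingleton (v := fun _ : Unit => v) () (hv.ne_zero 0)) (hsingle 1)
  obtain ⟨e, he, hk⟩ := hk ()
  -- the conjugates of `a` and `b` in suitable bases
  set a' : SL2 := h⁻¹ * a * h with ha'
  set b' : SL2 := k⁻¹ * b * k with hb'
  have hae : a' • (Pi.single 0 1 : Fin 2 → K) = lam • Pi.single 0 1 := by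
    rw [ha', mul_smul, mul_smul, hh, smul_comm a c, hlam, smul_comm c lam, ← hh, smul_comm,
      inv_smul_smul]
  have ha00 : a'.1 0 0 = lam := by
    have := congrFun hae 0
    rw [sl_two_smul_apply] at this
    simpa using this
  have ha10 : a'.1 1 0 = 0 := by
    have := congrFun hae 1
    rw [sl_two_smul_apply] at this
    simpa using this
  have ha11 : a'.1 1 1 = lam := by
    have hdet := a'.2
    rw [Matrix.det_fin_two, ha00, ha10] at hdet
    linear_combination lam * hdet - a'.1 1 1 * hlam2
  have ha01 : a'.1 0 1 ≠ 0 := by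
    intro h0
    apply ha
    have hcen : a' ∈ Subgroup.center SL2 := by
      refine Matrix.SpecialLinearGroup.mem_center_iff.2 ⟨lam, by simpa using hlam2, ?_⟩
      ext i j
      fin_cases i <;> fin_cases j <;> simp [ha00, ha10, ha11, h0]
    have : a = h * a' * h⁻¹ := by rw [ha']; group
    rw [this]
    exact Subgroup.Normal.conj_mem inferInstance _ hcen _
  have hb01 : b'.1 0 1 ≠ 0 := by
    intro h0
    have hbe : b' • (Pi.single 1 1 : Fin 2 → K) = b'.1 1 1 • Pi.single 1 1 := by
      ext i
      rw [sl_two_smul_apply]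
      fin_cases i <;> simp [h0]
    have hbv : b • v = b'.1 1 1 • v := by
      have h1 : k • b' • (Pi.single 1 1 : Fin 2 → K) = e • b • v := by
        rw [hb', mul_smul, mul_smul, smul_inv_smul, hk, smul_comm]
      rw [hbe, smul_comm, hk, smul_comm] at h1
      exact (smul_right_injective _ he h1).symm
    rw [LinearIndependent.pair_iff] at hv
    exact one_ne_zero (hv (-b'.1 1 1) 1 (by rw [hbv]; module)).2
  obtain ⟨r, hr⟩ := exists_quadratic_sq_ne_four hq
    (α := lam * b'.1.trace + a'.1 0 1 * b'.1 1 0) (β := a'.1 0 1 * (b'.1 0 0 - b'.1 1 1))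
    (γ := -(a'.1 0 1 * b'.1 0 1)) (neg_ne_zero.2 (mul_ne_zero ha01 hb01))
  apply hr
  let t : SL2 := Matrix.SpecialLinearGroup.transvection (by decide : (1 : Fin 2) ≠ 0) r
  have hfix : fixCard (a' * (t * b' * t⁻¹)) = 1 := by
    rw [← hone (h * t * k⁻¹), ← fixCard_conj (a' * (t * b' * t⁻¹)) h]
    congr 1
    rw [ha', hb']
    group
  rw [← (trace_sq_eq_four_of_fixCard_eq_one hfix).1]
  congr 1
  simp only [Matrix.SpecialLinearGroup.coe_mul, Matrix.SpecialLinearGroup.coe_inv,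
    Matrix.adjugate_fin_two, Matrix.trace_fin_two, Matrix.mul_apply, Fin.sum_univ_two, ha00, ha10,
    ha11]
  simp [t, Matrix.SpecialLinearGroup.transvection_coe]
  ring

end DimensionTwo

/-! ### Fields with two or three elements -/

section SmallFields

/-- The Klein four-group is abelian, and so is the quotient by it, as it is the commutator
subgroup. -/
instance isSolvable_alternatingGroup_fin_four : Group.IsSolvable (alternatingGroup (Fin 4)) := by
  have h4 : Nat.card (Fin 4) = 4 := by simp
  have hV := alternatingGroup.kleinFour_eq_commutator h4
  have hK := alternatingGroup.kleinFour_isKleinFour h4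
  have := alternatingGroup.normal_kleinFour h4
  have hcomm : Group.IsSolvable (alternatingGroup.kleinFour (Fin 4)) :=
    Group.isSolvable_of_comm
      (IsKleinFour.isMulCommutative (G := alternatingGroup.kleinFour (Fin 4))).is_comm.comm
  have hquot :
      Group.IsSolvable (alternatingGroup (Fin 4) ⧸ alternatingGroup.kleinFour (Fin 4)) := by
    apply Group.isSolvable_of_comm
    rintro ⟨x⟩ ⟨y⟩
    change QuotientGroup.mk x * QuotientGroup.mk y = QuotientGroup.mk y * QuotientGroup.mk x
    rw [← QuotientGroup.mk_mul, ← QuotientGroup.mk_mul, QuotientGroup.eq, hV]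
    have := Subgroup.commutator_mem_commutator (Subgroup.mem_top y⁻¹) (Subgroup.mem_top x⁻¹)
    rw [commutatorElement_def] at this
    simpa [mul_assoc, commutator_def] using this
  exact (Group.isSolvable_iff_subgroup_quotient (alternatingGroup.kleinFour (Fin 4))).2
    ⟨hcomm, hquot⟩

lemma isSolvable_perm_fin_four : Group.IsSolvable (Equiv.Perm (Fin 4)) := by
  refine Group.isSolvable_of_ker_le_range (alternatingGroup (Fin 4)).subtype Equiv.Perm.sign ?_
  rw [Subgroup.range_subtype]
  rfl

/-- Over a field with two or three elements there are at most four lines, so the group embeds into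
the symmetric group on four letters and is solvable, but two elementary transvections do not
commute. -/
theorem four_le_card_of_isSimpleGroup {K : Type*} [Field K] [Finite K]
    (hS : IsSimpleGroup (Matrix.ProjectiveSpecialLinearGroup (Fin 2) K)) : 4 ≤ Nat.card K := by
  by_contra hq
  have hcard : Nat.card (ℙ K (Fin 2 → K)) ≤ 4 := by
    rw [Projectivization.card_of_finrank_two K _ (by simp)]
    omega
  obtain ⟨ι⟩ : Nonempty (ℙ K (Fin 2 → K) ↪ Fin 4) := by
    have := Fintype.ofFinite (ℙ K (Fin 2 → K))
    rw [Nat.card_eq_fintype_card] at hcard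
    exact Function.Embedding.nonempty_of_card_le (by simpa using hcard)
  have := isSolvable_perm_fin_four
  have hsolv : Group.IsSolvable (Matrix.ProjectiveSpecialLinearGroup (Fin 2) K) :=
    Group.isSolvable_of_isSolvable_injective
      (f := (Equiv.Perm.viaEmbeddingHom ι).comp Projectivization.PSLAction.toPermHom)
      ((Equiv.Perm.viaEmbeddingHom_injective ι).comp
        Matrix.ProjectiveSpecialLinearGroup.toPermHom_injective)
  have hcomm := IsSimpleGroup.comm_iff_isSolvable.2 hsolv
  have h01 : (0 : Fin 2) ≠ 1 := by decide
  have h := hcomm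
    (Matrix.SpecialLinearGroup.transvection h01 (1 : K) : Matrix.SpecialLinearGroup (Fin 2) K)
    (Matrix.SpecialLinearGroup.transvection h01.symm (1 : K) : Matrix.SpecialLinearGroup (Fin 2) K)
  rw [← QuotientGroup.mk_mul, ← QuotientGroup.mk_mul, QuotientGroup.eq,
    Matrix.SpecialLinearGroup.mem_center_iff] at h
  obtain ⟨r, -, hr⟩ := h
  set t := Matrix.SpecialLinearGroup.transvection h01 (1 : K) *
    Matrix.SpecialLinearGroup.transvection h01.symm (1 : K) with ht
  have h1 : t.1 * Matrix.scalar (Fin 2) r =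
      (Matrix.SpecialLinearGroup.transvection h01.symm (1 : K) *
        Matrix.SpecialLinearGroup.transvection h01 (1 : K)).1 := by
    rw [hr, ← Matrix.SpecialLinearGroup.coe_mul, mul_inv_cancel_left]
  have e01 := congrFun (congrFun h1 0) 1
  have e00 := congrFun (congrFun h1 0) 0
  simp [ht, Matrix.SpecialLinearGroup.transvection_coe, Matrix.mul_apply, Fin.sum_univ_two]
    at e01 e00
  rw [e01] at e00
  simp at e00

end SmallFields

/-! ### Fixed lines on products of conjugacy classes -/

section Conclusion

variable {d : ℕ} {K : Type*} [Field K]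

local notation "SLd" => Matrix.SpecialLinearGroup (Fin d) K

/-- The number of fixed lines is not constant on the products of `a` with the conjugates
of `b`. -/
theorem not_exists_fixCard_mul_conj_eq [Finite K] (hd : 2 ≤ d) (hq : d = 2 → 4 ≤ Nat.card K)
    {a b : SLd} (ha : a ∉ Subgroup.center SLd) (hb : b ∉ Subgroup.center SLd) :
    ¬ ∃ c : ℕ, ∀ g : SLd, fixCard (a * (g * b * g⁻¹)) = c := by
  rintro ⟨c, hc⟩
  have hc1 : c = 1 := by
    have h2 := not_two_le_of_fixCard_mul_conj_eq hd ha hb hc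
    obtain ⟨g, hg⟩ := exists_one_le_fixCard ha hb
    rw [hc] at hg
    omega
  subst hc1
  wlog hfa : fixCard a = 1 generalizing a b
  · refine this hb ha (fun g => (fixCard_mul_conj_comm a b g).trans (hc g⁻¹)) ?_
    have h := fixCard_mul_conj_formula hd hc
    rw [Nat.cast_one, sub_self, mul_zero, eq_comm, mul_eq_zero] at h
    omega
  obtain rfl | hd3 : d = 2 ∨ 3 ≤ d := by omega
  · obtain ⟨g, hg⟩ := exists_fixCard_ne_one_of_dim_two (hq rfl) ha hb hfa
    exact hg (hc g)
  · obtain ⟨g, hg⟩ := exists_two_le_fixCard hd3 ha hb hfa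
    rw [hc] at hg
    omega

lemma two_le_of_not_mem_center {g : SLd} (hg : g ∉ Subgroup.center SLd) : 2 ≤ d := by
  obtain ⟨v, hv⟩ := exists_linearIndependent_of_not_mem_center hg
  simpa using hv.fintype_card_le_finrank

end Conclusion

theorem mainTheorem12 (d : ℕ) (K : Type*) [Field K] [Finite K]
    (hS : IsSimpleGroup (Matrix.ProjectiveSpecialLinearGroup (Fin d) K))
    (A B : ConjClasses (Matrix.ProjectiveSpecialLinearGroup (Fin d) K))
    (hA : A ≠ 1) (hB : B ≠ 1) :
    (¬ ∃ n : ℕ, ∀ g ∈ A.carrier * B.carrier, numFixedOneSpaces g = n) ∧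
      ¬ ∃ C : ConjClasses (Matrix.ProjectiveSpecialLinearGroup (Fin d) K),
        A.carrier * B.carrier = C.carrier := by
  have hrep : ∀ C : ConjClasses (Matrix.ProjectiveSpecialLinearGroup (Fin d) K),
      ∃ g : Matrix.SpecialLinearGroup (Fin d) K,
        ConjClasses.mk (g : Matrix.ProjectiveSpecialLinearGroup (Fin d) K) = C := by
    intro C
    obtain ⟨x, rfl⟩ := ConjClasses.exists_rep C
    obtain ⟨g, rfl⟩ := QuotientGroup.mk_surjective x
    exact ⟨g, rfl⟩
  have hcen : ∀ g : Matrix.SpecialLinearGroup (Fin d) K,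
      ConjClasses.mk (g : Matrix.ProjectiveSpecialLinearGroup (Fin d) K) ≠ 1 →
        g ∉ Subgroup.center _ := by
    intro g hg hmem
    apply hg
    rw [(QuotientGroup.eq_one_iff g).2 hmem, ConjClasses.one_eq_mk_one]
  have hfirst : ¬ ∃ n : ℕ, ∀ g ∈ A.carrier * B.carrier, numFixedOneSpaces g = n := by
    obtain ⟨a, rfl⟩ := hrep A
    obtain ⟨b, rfl⟩ := hrep B
    rintro ⟨n, hn⟩
    have hd := two_le_of_not_mem_center (hcen a hA)
    have hq : d = 2 → 4 ≤ Nat.card K := by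
      rintro rfl
      exact four_le_card_of_isSimpleGroup hS
    refine not_exists_fixCard_mul_conj_eq hd hq (hcen a hA) (hcen b hB) ⟨n, fun g => ?_⟩
    rw [← numFixedOneSpaces_mk]
    apply hn
    rw [QuotientGroup.mk_mul]
    refine Set.mul_mem_mul ConjClasses.mem_carrier_mk ?_
    rw [ConjClasses.mem_carrier_iff_mk_eq, ConjClasses.mk_eq_mk_iff_isConj]
    refine IsConj.symm (isConj_iff.2 ⟨(g : Matrix.ProjectiveSpecialLinearGroup (Fin d) K), ?_⟩)
    rfl
  refine ⟨hfirst, ?_⟩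
  rintro ⟨C, hC⟩
  obtain ⟨x, rfl⟩ := hrep C
  refine hfirst ⟨fixCard x, fun g hg => ?_⟩
  rw [hC, ConjClasses.mem_carrier_iff_mk_eq, ConjClasses.mk_eq_mk_iff_isConj] at hg
  obtain ⟨y, hy⟩ := isConj_iff.1 hg.symm
  obtain ⟨y, rfl⟩ := QuotientGroup.mk_surjective y
  rw [← hy]
  exact fixCard_conj x y
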